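/- Let $V$ be a finite set of $n$ sites, let $G\in\mathbb{R}^{V\times V}$ be a symmetric matrix with nonnegative entries and $\sum_{i,j\in V}G_{i,j}=1$, and define $\pi_j=\sum_{i\in V}G_{i,j}$ and $A_{i,j}=G_{i,j}/\pi_j$ (with $A_{i,j}=0$ if $\pi_j=0$). Then for every quantum state (density operator) $\rho$ on $(\mathbb{C}^d)^{\otimes n}$, with one tensor factor $\mathbb{C}^d$ per site of $V$, there exists a fully separable state $\sigma$, i.e. a convex combination of tensor products of single-site states, such that $$\sum_{i,j\in V}G_{i,j}\,\|\rho^{i,j}-\sigma^{i,j}\|_1\;\le\;47\left(d^4\,\ln(d)\,\mathrm{tr}(A^2)\,\|\pi\|_2^2\right)^{1/5}+2\,\|\pi\|_2^2 ,$$ where $\|\cdot\|_1$ is the trace norm, $\|\pi\|_2^2=\sum_j\pi_j^2$, and $\rho^{i,j}$ is the reduction (partial trace) of $\rho$ to the sites $i$ and $j$ (to the single site $i$ if $i=j$). -/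

import Mathlib

/-! Finite-dimensional quantum systems on a finite set `V` of sites, each site carrying `ℂ^d`.
Operators on `(ℂ^d)^{⊗ V}` are complex matrices in the product basis, which is indexed by `V → Fin d`. -/

namespace QSites

noncomputable section

open scoped ComplexOrder

/-- A quantum state (density operator): a positive semidefinite matrix of trace one. -/
def IsState {ι : Type*} [Fintype ι] (ρ : Matrix ι ι ℂ) : Prop :=
  ρ.PosSemidef ∧ ρ.trace = 1

/-- The trace norm `‖M‖₁ = tr √(M* M)`: the sum of the singular values of `M`, i.e. of the square
roots of the eigenvalues (with multiplicity) of `M* M`. -/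
def traceNorm {ι : Type*} [Fintype ι] [DecidableEq ι] (M : Matrix ι ι ℂ) : ℝ :=
  ∑ k, Real.sqrt ((Matrix.isHermitian_conjTranspose_mul_self M).eigenvalues k)

/-- The configuration on `V` that is `x` on `S` and `z` off `S`. -/
def glue {V : Type*} [DecidableEq V] {d : ℕ} (S : Finset V)
    (x : {v // v ∈ S} → Fin d) (z : {v // v ∉ S} → Fin d) : V → Fin d :=
  fun v => if h : v ∈ S then x ⟨v, h⟩ else z ⟨v, h⟩

/-- The reduction of `ρ` to the sites in `S`: the partial trace over all sites outside `S`. -/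
def reduce {V : Type*} [Fintype V] [DecidableEq V] {d : ℕ} (S : Finset V)
    (ρ : Matrix (V → Fin d) (V → Fin d) ℂ) :
    Matrix ({v // v ∈ S} → Fin d) ({v // v ∈ S} → Fin d) ℂ :=
  Matrix.of fun x y => ∑ z : {v // v ∉ S} → Fin d, ρ (glue S x z) (glue S y z)

/-- The tensor product `⊗_{v ∈ V} τ_v` of single-site operators. -/
def productOp {V : Type*} [Fintype V] {d : ℕ} (τ : V → Matrix (Fin d) (Fin d) ℂ) :
    Matrix (V → Fin d) (V → Fin d) ℂ :=
  Matrix.of fun x y => ∏ v, τ v (x v) (y v)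

/-- Globally (fully) separable states: convex combinations of tensor products of single-site
states. -/
def IsFullySeparable {V : Type*} [Fintype V] {d : ℕ}
    (σ : Matrix (V → Fin d) (V → Fin d) ℂ) : Prop :=
  σ ∈ convexHull ℝ {ω | ∃ τ : V → Matrix (Fin d) (Fin d) ℂ, (∀ v, IsState (τ v)) ∧ ω = productOp τ}

/-- The column sums `π_j = ∑_i G_{ij}` of a weight matrix, as a vector of Euclidean space. -/
def colSum {V : Type*} [Fintype V] (G : Matrix V V ℝ) : EuclideanSpace ℝ V :=
  WithLp.toLp 2 fun j => ∑ i, G i j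

/-- The matrix `A_{ij} = G_{ij} / π_j`. For nonnegative `G`, a column with `π_j = 0` vanishes, and
the corresponding column of `A` is then zero by the convention `0 / 0 = 0`. -/
def normalized {V : Type*} [Fintype V] (G : Matrix V V ℝ) : Matrix V V ℝ :=
  Matrix.of fun i j => G i j / colSum G j

end

end QSites

/-!
The separable state is produced by a measure-and-condition scheme. Measure the sites of a set `C`
with an informationally complete measurement; given the outcomes, replace the conditional state of
the other sites by the product of its one-site marginals, and prepare an arbitrary pure state on the
sites of `C`. The result is separable (`sepState_isFullySeparable`), and on the sites off `C` it has
the same one-site reductions as `ρ`.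

For two sites `i ≠ j` off `C`, the difference between `ρ^{i,j}` and `σ^{i,j}` is the correlation of
`i` and `j` left after conditioning. The dual frame of the measurement writes it as an average, over
the outcomes at `C` and `j`, of the change of the conditional state of `i` caused by measuring `j`.
By the Cauchy–Schwarz inequality its squared Frobenius norm is at most `4 d ^ 2` times the gain in
the average purity of `i` from adding `j` to `C` (`sum_norm_sq_reduce_pair_le`). Purities lie between
`0` and `1`, so if the sites of `C` are drawn independently with the probabilities `π`, the total
gain over `m` steps is at most `1`, and some `C` of fewer than `m` sites has both average gain of
order `1 / m` and `π`-mass of order `m ‖π‖ ^ 2` (`exists_finset_gain_add_mass_le`). A pair with a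
site in `C` contributes at most `2` to the trace distance. This purity argument replaces a count of
mutual information.

The gain is an average over independent pairs of sites, while the claim concerns pairs drawn with
the weights `G`. Since `tr (A ^ 2) = ∑ G_{ij} ^ 2 / (π_i π_j)`, another use of Cauchy–Schwarz
(`sum_mul_sqrt_le`) costs a factor `√(tr (A ^ 2))`. Optimizing `m` gives the bound
`3 (4 d ^ 4 tr (A ^ 2) ‖π‖ ^ 2) ^ (1 / 3)` of `exists_separable_sum_traceNorm_le`. The exponent
`1 / 3` is better than `1 / 5` when the base is small, and trace distances are at most `2`
otherwise.
-/

namespace QSites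

noncomputable section

open scoped ComplexOrder BigOperators
open Function (update)

/-! ### The trace norm -/

lemma traceNorm_le_sqrt_card_mul {ι : Type*} [Fintype ι] [DecidableEq ι] (M : Matrix ι ι ℂ) :
    traceNorm M ≤ √(Fintype.card ι) * √(∑ a, ∑ b, ‖M a b‖ ^ 2) := by
  have h0 : ∀ k, 0 ≤ (Matrix.isHermitian_conjTranspose_mul_self M).eigenvalues k := fun k =>
    (Matrix.posSemidef_conjTranspose_mul_self M).eigenvalues_nonneg k
  have htr : ∑ k, (Matrix.isHermitian_conjTranspose_mul_self M).eigenvalues k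
      = ∑ a, ∑ b, ‖M a b‖ ^ 2 := by
    have h := (Matrix.isHermitian_conjTranspose_mul_self M).trace_eq_sum_eigenvalues
    have h2 : (M.conjTranspose * M).trace = ((∑ a, ∑ b, ‖M a b‖ ^ 2 : ℝ) : ℂ) := by
      rw [Finset.sum_comm]
      simp only [Matrix.trace, Matrix.diag, Matrix.mul_apply, Matrix.conjTranspose_apply]
      push_cast
      refine Finset.sum_congr rfl fun a _ => Finset.sum_congr rfl fun b _ => ?_
      rw [RCLike.star_def, Complex.conj_mul']
    rw [h2] at h
    have h3 := congrArg Complex.re h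
    simp only [← RCLike.ofReal_sum] at h3
    exact h3.symm
  have hcs : traceNorm M ^ 2 ≤ Fintype.card ι * ∑ a, ∑ b, ‖M a b‖ ^ 2 := by
    have := sq_sum_le_card_mul_sum_sq (s := Finset.univ)
      (f := fun k => √((Matrix.isHermitian_conjTranspose_mul_self M).eigenvalues k))
    simpa only [Real.sq_sqrt (h0 _), htr, Finset.card_univ, traceNorm] using this
  rw [← Real.sqrt_mul (Nat.cast_nonneg _)]
  exact Real.le_sqrt_of_sq_le hcs

/-- For Hermitian `H` the trace norm is the sum of the absolute values of the eigenvalues. -/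
lemma traceNorm_eq_sum_abs_eigenvalues {ι : Type*} [Fintype ι] [DecidableEq ι]
    {H : Matrix ι ι ℂ} (hH : H.IsHermitian) : traceNorm H = ∑ k, |hH.eigenvalues k| := by
  have hsq : (H.conjTranspose * H).charpoly =
      ∏ i, (Polynomial.X - Polynomial.C (((hH.eigenvalues i) ^ 2 : ℝ) : ℂ)) := by
    rw [hH.eq]
    conv_lhs => rw [hH.spectral_theorem, ← map_mul, Matrix.diagonal_mul_diagonal,
      Unitary.conjStarAlgAut_apply, Matrix.charpoly_mul_comm, ← mul_assoc]
    simp [Matrix.charpoly_diagonal, sq]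
  have hroots := (Matrix.isHermitian_conjTranspose_mul_self H).roots_charpoly_eq_eigenvalues
  have hne : ∏ i, (Polynomial.X - Polynomial.C (((hH.eigenvalues i) ^ 2 : ℝ) : ℂ)) ≠ 0 :=
    Finset.prod_ne_zero_iff.mpr fun i _ => Polynomial.X_sub_C_ne_zero _
  rw [hsq, Polynomial.roots_prod _ _ hne] at hroots
  simp only [Polynomial.roots_X_sub_C, Multiset.bind_singleton] at hroots
  have h := congrArg (fun s => (s.map fun x : ℂ => √x.re).sum) hroots
  simp only [Multiset.map_map, Function.comp_apply, Complex.ofReal_re, Real.sqrt_sq_eq_abs] at h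
  exact h.symm

/-- The trace distance of two states, without the customary factor `1 / 2`, is at most `2`. -/
lemma traceNorm_sub_le_two {ι : Type*} [Fintype ι] [DecidableEq ι] {ρ σ : Matrix ι ι ℂ}
    (hρ : IsState ρ) (hσ : IsState σ) : traceNorm (ρ - σ) ≤ 2 := by
  have hH : (ρ - σ).IsHermitian := hρ.1.isHermitian.sub hσ.1.isHermitian
  rw [traceNorm_eq_sum_abs_eigenvalues hH]
  have key : ∀ {τ : Matrix ι ι ℂ}, IsState τ → ∑ k, (dotProduct (star ⇑(hH.eigenvectorBasis k))
      (τ.mulVec ⇑(hH.eigenvectorBasis k))).re = 1 := by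
    intro τ hτ
    have h := LinearMap.trace_eq_sum_inner (Matrix.toEuclideanLin τ) hH.eigenvectorBasis
    rw [Matrix.toEuclideanLin_eq_toLin_orthonormal, Matrix.trace_toLin_eq, hτ.2] at h
    have h' := congrArg Complex.re h
    rw [Complex.re_sum] at h'
    rw [← Complex.one_re, h']
    refine Finset.sum_congr rfl fun k _ => ?_
    rw [EuclideanSpace.inner_eq_star_dotProduct, dotProduct_comm]
    rfl
  calc ∑ k, |hH.eigenvalues k|
      ≤ ∑ k, ((dotProduct (star ⇑(hH.eigenvectorBasis k))
          (ρ.mulVec ⇑(hH.eigenvectorBasis k))).re + (dotProduct (star ⇑(hH.eigenvectorBasis k))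
          (σ.mulVec ⇑(hH.eigenvectorBasis k))).re) := by
        refine Finset.sum_le_sum fun k _ => ?_
        rw [hH.eigenvalues_eq k, Matrix.sub_mulVec, dotProduct_sub]
        have h1 := hρ.1.re_dotProduct_nonneg ⇑(hH.eigenvectorBasis k)
        have h2 := hσ.1.re_dotProduct_nonneg ⇑(hH.eigenvectorBasis k)
        simp only [RCLike.re_to_complex, Complex.sub_re] at h1 h2 ⊢
        rw [abs_le]
        constructor <;> linarith
    _ = 2 := by
        rw [Finset.sum_add_distrib, key hρ, key hσ]
        norm_num

/-! ### Expectations of product operators -/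

section operators

variable {V : Type*} [Fintype V] [DecidableEq V] {d : ℕ}

lemma productOp_mul (A B : V → Matrix (Fin d) (Fin d) ℂ) :
    productOp A * productOp B = productOp fun v => A v * B v := by
  ext x y
  simp only [productOp, Matrix.mul_apply, Matrix.of_apply, ← Finset.prod_mul_distrib]
  rw [Finset.prod_univ_sum, Fintype.piFinset_univ]

omit [DecidableEq V] in
lemma productOp_conjTranspose (A : V → Matrix (Fin d) (Fin d) ℂ) :
    (productOp A).conjTranspose = productOp fun v => (A v).conjTranspose := by
  ext x y
  simp [productOp]

lemma trace_productOp (A : V → Matrix (Fin d) (Fin d) ℂ) :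
    (productOp A).trace = ∏ v, (A v).trace := by
  simp only [productOp, Matrix.trace, Matrix.diag, Matrix.of_apply]
  rw [Finset.prod_univ_sum, Fintype.piFinset_univ]

lemma exists_conjTranspose_mul_self {ι : Type*} [Fintype ι] [DecidableEq ι] {A : Matrix ι ι ℂ}
    (hA : A.PosSemidef) : ∃ B : Matrix ι ι ℂ, A = B.conjTranspose * B := by
  open scoped MatrixOrder Matrix.Norms.L2Operator in
  obtain ⟨B, hB⟩ := CStarAlgebra.nonneg_iff_eq_star_mul_self.mp hA.nonneg
  exact ⟨B, hB⟩

lemma productOp_posSemidef {A : V → Matrix (Fin d) (Fin d) ℂ} (hA : ∀ v, (A v).PosSemidef) :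
    (productOp A).PosSemidef := by
  choose B hB using fun v => exists_conjTranspose_mul_self (hA v)
  have : productOp A = (productOp B).conjTranspose * productOp B := by
    rw [productOp_conjTranspose, productOp_mul]
    exact congrArg productOp (funext hB)
  rw [this]
  exact Matrix.posSemidef_conjTranspose_mul_self _

lemma productOp_isState {s : V → Matrix (Fin d) (Fin d) ℂ} (hs : ∀ v, IsState (s v)) :
    IsState (productOp s) :=
  ⟨productOp_posSemidef fun v => (hs v).1, by simp [trace_productOp, (hs _).2]⟩

/-- The expectation `tr (ρ ⊗_v E_v)` of a product operator, as a multilinear function of its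
factors. -/
def expectation (ρ : Matrix (V → Fin d) (V → Fin d) ℂ) :
    MultilinearMap ℂ (fun _ : V => Matrix (Fin d) (Fin d) ℂ) ℂ :=
  ∑ x, ∑ y, ρ x y • (MultilinearMap.mkPiAlgebra ℂ V ℂ).compLinearMap
    fun v => Matrix.entryLinearMap ℂ ℂ (y v) (x v)

lemma expectation_apply (ρ : Matrix (V → Fin d) (V → Fin d) ℂ)
    (E : V → Matrix (Fin d) (Fin d) ℂ) :
    expectation ρ E = ∑ x, ∑ y, ρ x y * ∏ v, E v (y v) (x v) := by
  simp [expectation]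

lemma expectation_eq_trace (ρ : Matrix (V → Fin d) (V → Fin d) ℂ)
    (E : V → Matrix (Fin d) (Fin d) ℂ) :
    expectation ρ E = (ρ * productOp E).trace := by
  simp [expectation_apply, Matrix.trace, Matrix.mul_apply, productOp]

lemma expectation_productOp (s E : V → Matrix (Fin d) (Fin d) ℂ) :
    expectation (productOp s) E = ∏ v, (s v * E v).trace := by
  rw [expectation_eq_trace, productOp_mul, trace_productOp]

lemma expectation_one {ρ : Matrix (V → Fin d) (V → Fin d) ℂ} (hρ : IsState ρ) :
    expectation ρ (fun _ => 1) = 1 := by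
  have : productOp (fun _ : V => (1 : Matrix (Fin d) (Fin d) ℂ)) = 1 := by
    ext x y
    simp [productOp, Matrix.one_apply, Finset.prod_ite_zero, funext_iff]
  rw [expectation_eq_trace, this, mul_one, hρ.2]

lemma expectation_nonneg {ρ : Matrix (V → Fin d) (V → Fin d) ℂ} (hρ : ρ.PosSemidef)
    {E : V → Matrix (Fin d) (Fin d) ℂ} (hE : ∀ v, (E v).PosSemidef) : 0 ≤ expectation ρ E := by
  obtain ⟨B, hB⟩ := exists_conjTranspose_mul_self (productOp_posSemidef hE)
  rw [expectation_eq_trace, hB, ← mul_assoc, Matrix.trace_mul_comm, ← mul_assoc]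
  exact (hρ.mul_mul_conjTranspose_same B).trace_nonneg

/-! ### Reductions -/

lemma sum_glue {M : Type*} [AddCommMonoid M] (S : Finset V) (f : (V → Fin d) → M) :
    ∑ u, f u = ∑ x, ∑ z, f (glue S x z) := by
  rw [← Fintype.sum_prod_type']
  exact (Equiv.sum_comp (Equiv.piEquivPiSubtypeProd (fun v => v ∈ S) (fun _ => Fin d)).symm f).symm

lemma reduce_isState {ρ : Matrix (V → Fin d) (V → Fin d) ℂ} (hρ : IsState ρ) (S : Finset V) :
    IsState (reduce S ρ) := by
  constructor
  · have : reduce S ρ = ∑ z, ρ.submatrix (fun x => glue S x z) (fun x => glue S x z) := by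
      ext x y
      simp [reduce, Matrix.sum_apply]
    rw [this]
    exact Matrix.posSemidef_sum _ fun z _ => hρ.1.submatrix _
  · rw [← hρ.2, Matrix.trace, Matrix.trace, sum_glue S]
    rfl

/-- The operators measured by an entry of a reduction: matrix units on `S`, identities off `S`. -/
def entryOp (S : Finset V) (x y : {v // v ∈ S} → Fin d) : V → Matrix (Fin d) (Fin d) ℂ :=
  fun v => if h : v ∈ S then Matrix.single (y ⟨v, h⟩) (x ⟨v, h⟩) 1 else 1

lemma reduce_apply (S : Finset V) (ρ : Matrix (V → Fin d) (V → Fin d) ℂ)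
    (x y : {v // v ∈ S} → Fin d) : reduce S ρ x y = expectation ρ (entryOp S x y) := by
  have hprod : ∀ x' y' z z', ∏ v, entryOp S x y v (glue S y' z' v) (glue S x' z v)
      = if x = x' then if y = y' then if z = z' then (1 : ℂ) else 0 else 0 else 0 := by
    intro x' y' z z'
    rw [← Fintype.prod_subtype_mul_prod_subtype (fun v => v ∈ S)]
    have h1 : ∀ v : {v // v ∈ S}, entryOp S x y v (glue S y' z' v) (glue S x' z v)
        = if x v = x' v ∧ y v = y' v then 1 else 0 := by
      rintro ⟨v, hv⟩
      simp [entryOp, glue, hv, Matrix.single_apply, and_comm]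
    have h2 : ∀ v : {v // v ∉ S}, entryOp S x y v (glue S y' z' v) (glue S x' z v)
        = if z v = z' v then 1 else 0 := by
      rintro ⟨v, hv⟩
      simp [entryOp, glue, hv, Matrix.one_apply, eq_comm]
    have e1 : (∀ v ∈ Finset.univ, x v = x' v ∧ y v = y' v) ↔ x = x' ∧ y = y' := by
      simp [funext_iff, forall_and]
    have e2 : (∀ v ∈ Finset.univ, z v = z' v) ↔ z = z' := by
      simp [funext_iff]
    simp only [h1, h2, Finset.prod_ite_zero, e2]
    split_ifs <;> simp_all
  rw [expectation_apply, sum_glue S]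
  simp only [sum_glue S, hprod]
  simp [reduce]

end operators

/-! ### Informationally complete measurements -/

/-- A POVM on `ℂ^d` with outcomes in `Ω` and a dual frame reconstructing an operator from its
outcome statistics. The POVM elements are normalized so that their average, rather than their sum,
is the identity, and the dual operators have Frobenius norm `2 * d`. The field `expect_dual_smul` says
`B = 𝔼 y, tr (op y * B) • dual y` for every `B`, read off on matrix entries. -/
structure MeasurementFrame (d : ℕ) (Ω : Type*) [Fintype Ω] where
  op : Ω → Matrix (Fin d) (Fin d) ℂ
  dual : Ω → Matrix (Fin d) (Fin d) ℂ
  op_posSemidef : ∀ y, (op y).PosSemidef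
  expect_op : 𝔼 y, op y = 1
  expect_dual_smul : ∀ a b, 𝔼 y, dual y a b • op y = Matrix.single b a 1
  sum_norm_dual : ∀ y, ∑ a, ∑ b, ‖dual y a b‖ ^ 2 = 4 * (d : ℝ) ^ 2

lemma expect_eq_inv_card_smul_sum {ι E : Type*} [AddCommGroup E] [Module ℂ E] [Module ℚ≥0 E]
    (s : Finset ι) (f : ι → E) : 𝔼 i ∈ s, f i = (s.card : ℂ)⁻¹ • ∑ i ∈ s, f i := by
  rw [Finset.expect, ← NNRat.cast_smul_eq_nnqsmul ℂ]
  simp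

/-- The vector `e_a + i^k e_b`. -/
def phaseVec {d : ℕ} (a b : Fin d) (k : Fin 4) : Fin d → ℂ :=
  Pi.single a 1 + Complex.I ^ (k : ℕ) • Pi.single b 1

lemma vecMulVec_phaseVec {d : ℕ} (a b : Fin d) (k : Fin 4) :
    Matrix.vecMulVec (phaseVec a b k) (star (phaseVec a b k)) =
      Matrix.single a a 1 + Matrix.single b b 1 + (-Complex.I) ^ (k : ℕ) • Matrix.single a b 1
        + Complex.I ^ (k : ℕ) • Matrix.single b a 1 := by
  have hI : Complex.I ^ (k : ℕ) * (-Complex.I) ^ (k : ℕ) = 1 := by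
    rw [← mul_pow]; simp
  ext x y
  simp only [phaseVec, Matrix.vecMulVec_apply, Pi.add_apply, Pi.star_apply, Pi.smul_apply,
    smul_eq_mul, star_add, star_mul', star_pow, Complex.star_def, Complex.conj_I,
    Matrix.add_apply, Matrix.smul_apply, Matrix.single_apply, Pi.single_apply, apply_ite (starRingEnd ℂ),
    map_one, map_zero, ite_and, eq_comm (a := x), eq_comm (a := y)]
  split_ifs <;> first | linear_combination hI | ring

lemma sum_vecMulVec_phaseVec {d : ℕ} (a b : Fin d) :
    ∑ k, Matrix.vecMulVec (phaseVec a b k) (star (phaseVec a b k)) =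
      (4 : ℂ) • (Matrix.single a a 1 + Matrix.single b b 1) := by
  have h3 : Complex.I ^ 3 = -Complex.I := Complex.I_pow_three
  simp only [vecMulVec_phaseVec, Fin.sum_univ_four]
  generalize Matrix.single a a (1 : ℂ) = A, Matrix.single b b (1 : ℂ) = B,
    Matrix.single a b (1 : ℂ) = X, Matrix.single b a (1 : ℂ) = Y
  norm_num [neg_pow Complex.I, h3]
  module

/-- Polarization: the phases single out one of the four terms of `vecMulVec_phaseVec`. -/
lemma sum_smul_vecMulVec_phaseVec {d : ℕ} (a b : Fin d) :
    ∑ k : Fin 4, Complex.I ^ (k : ℕ) • Matrix.vecMulVec (phaseVec a b k) (star (phaseVec a b k)) =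
      (4 : ℂ) • Matrix.single a b 1 := by
  have h3 : Complex.I ^ 3 = -Complex.I := Complex.I_pow_three
  simp only [vecMulVec_phaseVec, Fin.sum_univ_four, smul_add, smul_smul, ← mul_pow]
  generalize Matrix.single a a (1 : ℂ) = A, Matrix.single b b (1 : ℂ) = B,
    Matrix.single a b (1 : ℂ) = X, Matrix.single b a (1 : ℂ) = Y
  norm_num [neg_pow Complex.I, h3, ← sq, ← pow_mul]
  module

/-- The frame of the vectors `e_a + i^k e_b`, whose projections determine all matrix entries by
polarization. -/
def pairFrame (d : ℕ) [NeZero d] : MeasurementFrame d (Fin d × Fin d × Fin 4) where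
  op y := ((d : ℂ) / 2) •
    Matrix.vecMulVec (phaseVec y.1 y.2.1 y.2.2) (star (phaseVec y.1 y.2.1 y.2.2))
  dual y := (2 * d * Complex.I ^ (y.2.2 : ℕ)) • Matrix.single y.2.1 y.1 1
  op_posSemidef y := by
    refine (Matrix.posSemidef_vecMulVec_self_star _).smul ?_
    positivity
  expect_op := by
    have hd : (d : ℂ) ≠ 0 := NeZero.ne _
    have h1 : ∑ a : Fin d, Matrix.single a a (1 : ℂ) = 1 := by
      ext x y
      simp [Matrix.sum_apply, Matrix.single_apply, Matrix.one_apply, ite_and]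
    rw [expect_eq_inv_card_smul_sum, ← Finset.smul_sum]
    simp only [Fintype.sum_prod_type, sum_vecMulVec_phaseVec, ← Finset.smul_sum,
      Finset.sum_add_distrib, Finset.sum_const, Finset.card_univ, Fintype.card_prod,
      Fintype.card_fin, h1, ← Nat.cast_smul_eq_nsmul ℂ, ← add_smul, smul_smul]
    convert one_smul ℂ _ using 2
    push_cast
    field_simp
    norm_num
  expect_dual_smul a b := by
    have hd : (d : ℂ) ≠ 0 := NeZero.ne _
    rw [expect_eq_inv_card_smul_sum]
    have h : ∀ y : Fin d × Fin d × Fin 4,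
        ((2 * d * Complex.I ^ (y.2.2 : ℕ)) • Matrix.single y.2.1 y.1 (1 : ℂ)) a b •
          (((d : ℂ) / 2) • Matrix.vecMulVec (phaseVec y.1 y.2.1 y.2.2)
            (star (phaseVec y.1 y.2.1 y.2.2)))
        = if y.1 = b then if y.2.1 = a then (d ^ 2 : ℂ) • Complex.I ^ (y.2.2 : ℕ) •
            Matrix.vecMulVec (phaseVec y.1 y.2.1 y.2.2) (star (phaseVec y.1 y.2.1 y.2.2))
            else 0 else 0 := by
      intro y
      rw [Matrix.smul_apply, Matrix.single_apply]
      split_ifs <;> simp_all [smul_smul]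
      ring_nf
    simp only [h, Fintype.sum_prod_type]
    simp only [Finset.sum_ite_irrel, Finset.sum_const_zero, Finset.sum_ite_eq', Finset.mem_univ,
      if_true]
    rw [← Finset.smul_sum, sum_smul_vecMulVec_phaseVec, smul_smul, smul_smul]
    convert one_smul ℂ _ using 2
    simp
    field_simp
  sum_norm_dual y := by
    simp only [Matrix.smul_apply, Matrix.single_apply, smul_eq_mul]
    rw [Finset.sum_eq_single y.2.1, Finset.sum_eq_single y.1]
    · simp [mul_pow]; norm_num
    · intro b _ hb; simp [hb.symm]
    · simp
    · intro b _ hb; simp [hb.symm]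
    · simp

/-! ### Averages -/

lemma re_expect {ι : Type*} (s : Finset ι) (f : ι → ℂ) : (𝔼 i ∈ s, f i).re = 𝔼 i ∈ s, (f i).re := by
  rw [Finset.expect_eq_sum_div_card, Finset.expect_eq_sum_div_card, Complex.div_natCast_re,
    Complex.re_sum]

lemma ofReal_expect {ι : Type*} (s : Finset ι) (f : ι → ℝ) :
    ((𝔼 i ∈ s, f i : ℝ) : ℂ) = 𝔼 i ∈ s, (f i : ℂ) := by
  simp [Finset.expect_eq_sum_div_card]

section averages

variable {V : Type*} [Fintype V] [DecidableEq V] {Ω : Type*} [Fintype Ω]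

/-- Averaging a function over all configurations can be done by resampling one coordinate. -/
lemma expect_update {E : Type*} [AddCommMonoid E] [Module ℚ≥0 E] (j : V) (f : (V → Ω) → E) :
    𝔼 z, 𝔼 y, f (update z j y) = 𝔼 z, f z := by
  rcases isEmpty_or_nonempty Ω with h | h
  · have : IsEmpty (V → Ω) := ⟨fun z => h.false (z j)⟩
    simp [Finset.univ_eq_empty]
  -- The map `(z, y) ↦ (z with z_j replaced by y, z_j)` is an involution.
  let e : (V → Ω) × Ω ≃ (V → Ω) × Ω :=
    { toFun := fun p => (update p.1 j p.2, p.1 j)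
      invFun := fun p => (update p.1 j p.2, p.1 j)
      left_inv := fun p => by simp
      right_inv := fun p => by simp }
  calc 𝔼 z, 𝔼 y, f (update z j y) = 𝔼 p : (V → Ω) × Ω, f (e p).1 :=
        (Finset.expect_product' Finset.univ Finset.univ fun z y => f (update z j y)).symm
    _ = 𝔼 p : (V → Ω) × Ω, f p.1 := Fintype.expect_equiv e _ _ fun _ => rfl
    _ = 𝔼 z, 𝔼 _y : Ω, f z := Finset.expect_product' Finset.univ Finset.univ fun z _ => f z
    _ = 𝔼 z, f z := by simp

lemma expect_multilinear {E : Type*} [AddCommGroup E] [Module ℂ E] [Module ℚ≥0 E]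
    (g : MultilinearMap ℂ (fun _ : V => E) ℂ) (F : V → Ω → E) :
    𝔼 z : V → Ω, g (fun v => F v (z v)) = g fun v => 𝔼 y, F v y := by
  simp only [expect_eq_inv_card_smul_sum]
  rw [g.map_smul_univ, g.map_sum]
  simp

omit [Fintype V] in
lemma multilinear_update_expect {E : Type*} [AddCommGroup E] [Module ℂ E] [Module ℚ≥0 E]
    (g : MultilinearMap ℂ (fun _ : V => E) ℂ) (j : V) (m : V → E) (F : Ω → E) :
    g (update m j (𝔼 y, F y)) = 𝔼 y, g (update m j (F y)) := by
  simp only [expect_eq_inv_card_smul_sum]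
  rw [g.map_update_smul, g.map_update_sum]

lemma expect_sq_le_expect_mul_expect {ι : Type*} [Fintype ι] {r f g : ι → ℝ} (hf : ∀ i, 0 ≤ f i)
    (hg : ∀ i, 0 ≤ g i) (h : ∀ i, r i ^ 2 = f i * g i) : (𝔼 i, r i) ^ 2 ≤ (𝔼 i, f i) * 𝔼 i, g i := by
  simp only [Fintype.expect_eq_sum_div_card, div_pow, div_mul_div_comm, ← sq]
  gcongr
  exact Finset.sum_sq_le_sum_mul_sum_of_sq_le_mul _ (fun i _ => hf i) (fun i _ => hg i)
    fun i _ => (h i).le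

/-- Two functions of the outcomes have equal averages if averaging over the outcome at one site
turns the first into the second. -/
lemma expect_eq_of_resample {E : Type*} [AddCommMonoid E] [Module ℚ≥0 E] (j : V) {f g : (V → Ω) → E}
    (h : ∀ z, 𝔼 y, f (update z j y) = g z) : 𝔼 z, f z = 𝔼 z, g z := by
  rw [← expect_update j f]
  exact Finset.expect_congr rfl fun z _ => h z

end averages

/-! ### Conditioning on measured sites -/

/-- A positive linear functional, read off on matrix units, gives a positive semidefinite matrix. -/
lemma posSemidef_of_linear_nonneg {d : ℕ} (g : Matrix (Fin d) (Fin d) ℂ →ₗ[ℂ] ℂ)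
    (hg : ∀ A : Matrix (Fin d) (Fin d) ℂ, A.PosSemidef → 0 ≤ g A) :
    (Matrix.of fun a b => g (Matrix.single b a 1)).PosSemidef := by
  have hq : ∀ x : Fin d → ℂ, dotProduct (star x)
      ((Matrix.of fun a b => g (Matrix.single b a 1)).mulVec x) =
        g (Matrix.vecMulVec x (star x)) := by
    intro x
    have h : Matrix.vecMulVec x (star x) =
        ∑ a, ∑ b, (star (x a) * x b) • Matrix.single b a (1 : ℂ) := by
      ext a b
      simp [Matrix.sum_apply, Matrix.vecMulVec_apply, Matrix.single_apply, ite_and, mul_comm]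
    rw [h]
    simp only [map_sum, map_smul, smul_eq_mul, dotProduct, Matrix.mulVec, Matrix.of_apply,
      Finset.mul_sum, Pi.star_apply]
    exact Finset.sum_congr rfl fun a _ => Finset.sum_congr rfl fun b _ => by ring
  rw [← Matrix.isPositive_toEuclideanLin_iff, LinearMap.isPositive_iff_complex]
  intro x
  have hx := hg _ (Matrix.posSemidef_vecMulVec_self_star x.ofLp)
  rw [← hq, dotProduct_comm] at hx
  have hin := EuclideanSpace.inner_eq_star_dotProduct x (Matrix.toEuclideanLin
    (Matrix.of fun a b => g (Matrix.single b a 1)) x)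
  obtain ⟨hre, him⟩ := Complex.nonneg_iff.mp (hin.symm ▸ hx)
  rw [← inner_conj_symm, Complex.conj_eq_iff_im.mpr him.symm]
  exact ⟨Complex.ext rfl him, hre⟩

lemma sum_norm_sq_le_trace_sq {ι : Type*} [Fintype ι] {A : Matrix ι ι ℂ} (hA : A.PosSemidef) :
    ∑ a, ∑ b, ‖A a b‖ ^ 2 ≤ A.trace.re ^ 2 := by
  have h : ∀ a b, ‖A a b‖ ^ 2 ≤ (A a a).re * (A b b).re := by
    intro a b
    have hdet := (hA.submatrix ![a, b]).det_nonneg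
    rw [Matrix.det_fin_two] at hdet
    simp only [Matrix.submatrix_apply, Matrix.cons_val_zero, Matrix.cons_val_one] at hdet
    have hba : A b a = star (A a b) := (hA.isHermitian.apply b a).symm
    have ha := (Complex.nonneg_iff.mp (hA.diag_nonneg (i := a))).2
    have hdet' := (Complex.nonneg_iff.mp hdet).1
    rw [hba, Complex.star_def, Complex.mul_conj'] at hdet'
    simp only [Complex.sub_re, Complex.mul_re, ← ha, ← Complex.ofReal_pow, Complex.ofReal_re] at hdet'
    linarith
  calc ∑ a, ∑ b, ‖A a b‖ ^ 2 ≤ ∑ a, ∑ b, (A a a).re * (A b b).re :=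
        Finset.sum_le_sum fun a _ => Finset.sum_le_sum fun b _ => h a b
    _ = A.trace.re ^ 2 := by
        simp only [Matrix.trace, Complex.re_sum, Matrix.diag, sq, Finset.sum_mul_sum]

section conditioning

variable {V : Type*} [Fintype V] [DecidableEq V] {d : ℕ} {Ω : Type*} [Fintype Ω]
  (F : MeasurementFrame d Ω) (ρ : Matrix (V → Fin d) (V → Fin d) ℂ) (C : Finset V) (z : V → Ω)

/-- The product operator for the event that the sites in `C` have the outcomes `z`. The values of
`z` off `C` are irrelevant, so that averages over all `z` are averages over outcomes on `C`. -/
def outcomeOp : V → Matrix (Fin d) (Fin d) ℂ := fun v => if v ∈ C then F.op (z v) else 1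

/-- The probability density, with respect to the uniform distribution, of the outcomes `z` on
`C`. -/
def outcomeProb : ℝ := (expectation ρ (outcomeOp F C z)).re

/-- For `i ∉ C`, the state of the site `i` conditioned on the outcomes `z` on `C`, not normalized:
its trace is `outcomeProb F ρ C z`. -/
def condOp (i : V) : Matrix (Fin d) (Fin d) ℂ :=
  Matrix.of fun a b => expectation ρ (update (outcomeOp F C z) i (Matrix.single b a 1))

variable {ρ C}

omit [Fintype V] in
lemma outcomeOp_posSemidef (v : V) : (outcomeOp F C z v).PosSemidef := by
  unfold outcomeOp
  split_ifs
  exacts [F.op_posSemidef _, Matrix.PosSemidef.one]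

lemma outcomeProb_nonneg (hρ : IsState ρ) : 0 ≤ outcomeProb F ρ C z :=
  (Complex.nonneg_iff.mp (expectation_nonneg hρ.1 (outcomeOp_posSemidef F z))).1

lemma ofReal_outcomeProb (hρ : IsState ρ) :
    (outcomeProb F ρ C z : ℂ) = expectation ρ (outcomeOp F C z) := by
  have := (Complex.nonneg_iff.mp (expectation_nonneg hρ.1 (outcomeOp_posSemidef F (C := C) z))).2
  exact Complex.ext rfl (by simpa using this)

lemma condOp_posSemidef (hρ : IsState ρ) (i : V) : (condOp F ρ C z i).PosSemidef := by
  refine posSemidef_of_linear_nonneg ((expectation ρ).toLinearMap (outcomeOp F C z) i) fun A hA => ?_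
  refine expectation_nonneg hρ.1 fun v => ?_
  rcases eq_or_ne v i with rfl | h
  · simpa using hA
  · simpa [h] using outcomeOp_posSemidef F z v

lemma trace_condOp (hρ : IsState ρ) {i : V} (hi : i ∉ C) :
    (condOp F ρ C z i).trace = outcomeProb F ρ C z := by
  have h1 : ∑ a : Fin d, Matrix.single a a (1 : ℂ) = 1 := by
    ext x y
    simp [Matrix.sum_apply, Matrix.single_apply, Matrix.one_apply, ite_and]
  rw [ofReal_outcomeProb F z hρ]
  simp only [condOp, Matrix.trace, Matrix.diag, Matrix.of_apply]
  rw [← (expectation ρ).map_update_sum, h1]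
  congr 1
  rw [Function.update_eq_self_iff]
  simp [outcomeOp, hi]

lemma sum_norm_sq_condOp_le (hρ : IsState ρ) {i : V} (hi : i ∉ C) :
    ∑ a, ∑ b, ‖condOp F ρ C z i a b‖ ^ 2 ≤ outcomeProb F ρ C z ^ 2 := by
  have := sum_norm_sq_le_trace_sq (condOp_posSemidef F z hρ i (C := C))
  rwa [trace_condOp F z hρ hi, Complex.ofReal_re] at this

lemma condOp_eq_zero (hρ : IsState ρ) {i : V} (hi : i ∉ C) (h0 : outcomeProb F ρ C z = 0) :
    condOp F ρ C z i = 0 := by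
  refine (condOp_posSemidef F z hρ i).trace_eq_zero_iff.mp ?_
  rw [trace_condOp F z hρ hi, h0, Complex.ofReal_zero]

omit [Fintype V] in
lemma outcomeOp_insert (j : V) :
    outcomeOp F (insert j C) z = update (outcomeOp F C z) j (F.op (z j)) := by
  ext1 v
  rcases eq_or_ne v j with rfl | h
  · simp [outcomeOp]
  · simp [outcomeOp, h]

omit [Fintype V] in
lemma outcomeOp_update {j : V} (hj : j ∉ C) (y : Ω) :
    outcomeOp F C (update z j y) = outcomeOp F C z := by
  ext1 v
  rcases eq_or_ne v j with rfl | h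
  · simp [outcomeOp, hj]
  · simp [outcomeOp, h]

lemma outcomeProb_update {j : V} (hj : j ∉ C) (y : Ω) :
    outcomeProb F ρ C (update z j y) = outcomeProb F ρ C z := by
  rw [outcomeProb, outcomeOp_update F z hj, outcomeProb]

lemma condOp_update {j : V} (hj : j ∉ C) (y : Ω) (i : V) :
    condOp F ρ C (update z j y) i = condOp F ρ C z i := by
  rw [condOp, outcomeOp_update F z hj, condOp]

lemma expect_outcomeProb_insert (hρ : IsState ρ) {j : V} (hj : j ∉ C) :
    𝔼 y, outcomeProb F ρ (insert j C) (update z j y) = outcomeProb F ρ C z := by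
  have : update (outcomeOp F C z) j 1 = outcomeOp F C z := by
    rw [Function.update_eq_self_iff]
    simp [outcomeOp, hj]
  apply Complex.ofReal_injective
  rw [ofReal_expect]
  simp only [ofReal_outcomeProb F _ hρ, outcomeOp_insert, outcomeOp_update F z hj,
    Function.update_self]
  rw [← multilinear_update_expect, F.expect_op, this]

lemma expect_condOp_insert {i j : V} (hij : i ≠ j) (hj : j ∉ C) (a b : Fin d) :
    𝔼 y, condOp F ρ (insert j C) (update z j y) i a b = condOp F ρ C z i a b := by
  have : update (outcomeOp F C z) j 1 = outcomeOp F C z := by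
    rw [Function.update_eq_self_iff]
    simp [outcomeOp, hj]
  simp only [condOp, Matrix.of_apply, outcomeOp_insert, outcomeOp_update F z hj,
    Function.update_self]
  simp_rw [Function.update_comm hij.symm]
  rw [← multilinear_update_expect, F.expect_op, Function.update_comm hij, this]

/-- The dual frame recovers a conditional state from the statistics of measuring its site. -/
lemma expect_dual_mul_outcomeProb (hρ : IsState ρ) {j : V} (hj : j ∉ C) (a b : Fin d) :
    𝔼 y, F.dual y a b * outcomeProb F ρ (insert j C) (update z j y) = condOp F ρ C z j a b := by
  simp only [ofReal_outcomeProb F _ hρ, outcomeOp_insert, outcomeOp_update F z hj,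
    Function.update_self, condOp, Matrix.of_apply]
  rw [← F.expect_dual_smul, multilinear_update_expect]
  simp only [MultilinearMap.map_update_smul, smul_eq_mul]

/-- Measuring the sites of `C` does not disturb expectations on the other sites. -/
lemma expect_expectation_piecewise [Nonempty Ω] (E : V → Ω → Matrix (Fin d) (Fin d) ℂ)
    (B : V → Matrix (Fin d) (Fin d) ℂ) (hB : ∀ v, v ∉ C → 𝔼 y, E v y = B v)
    (hC : ∀ v ∈ C, B v = 1) :
    𝔼 z : V → Ω, expectation ρ (fun v => if v ∈ C then F.op (z v) else E v (z v)) =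
      expectation ρ B := by
  have := expect_multilinear (expectation ρ) (fun v (y : Ω) => if v ∈ C then F.op y else E v y)
  rw [this]
  congr 1
  ext1 v
  by_cases hv : v ∈ C
  · simp only [hv, if_true, F.expect_op, hC]
  · simp only [hv, if_false, hB v hv]

lemma expect_outcomeProb [Nonempty Ω] (hρ : IsState ρ) : 𝔼 z, outcomeProb F ρ C z = 1 := by
  apply Complex.ofReal_injective
  rw [ofReal_expect, Complex.ofReal_one, ← expectation_one hρ]
  simp only [ofReal_outcomeProb F _ hρ]
  exact expect_expectation_piecewise F (fun _ _ => 1) _ (fun _ _ => by simp) fun _ _ => rfl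

lemma reduce_singleton_apply [Nonempty Ω] {i : V} (hi : i ∉ C)
    (x y : {v // v ∈ ({i} : Finset V)} → Fin d) :
    reduce {i} ρ x y = 𝔼 z, condOp F ρ C z i (x ⟨i, by simp⟩) (y ⟨i, by simp⟩) := by
  rw [reduce_apply, ← expect_expectation_piecewise F (fun v _ => entryOp {i} x y v) _
    (fun v _ => by simp) (C := C)]
  · refine Finset.expect_congr rfl fun z _ => ?_
    simp only [condOp, Matrix.of_apply]
    congr 1
    ext1 v
    rcases eq_or_ne v i with rfl | h
    · simp [hi, entryOp]
    · simp [outcomeOp, h, entryOp]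
  · intro v hv
    have : v ≠ i := fun h => hi (h ▸ hv)
    simp [entryOp, this]

lemma reduce_pair_apply [Nonempty Ω] {i j : V} (hij : i ≠ j) (hi : i ∉ C) (hj : j ∉ C)
    (x y : {v // v ∈ ({i, j} : Finset V)} → Fin d) :
    reduce {i, j} ρ x y = 𝔼 z, F.dual (z j) (x ⟨j, by simp⟩) (y ⟨j, by simp⟩) *
      condOp F ρ (insert j C) z i (x ⟨i, by simp⟩) (y ⟨i, by simp⟩) := by
  rw [reduce_apply, ← expect_expectation_piecewise F (fun v w => if v = j then
    F.dual w (x ⟨j, by simp⟩) (y ⟨j, by simp⟩) • F.op w else entryOp {i, j} x y v) _ _ (C := C)]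
  · refine Finset.expect_congr rfl fun z _ => ?_
    simp only [condOp, Matrix.of_apply, outcomeOp_insert]
    rw [Function.update_comm hij.symm, ← smul_eq_mul, ← MultilinearMap.map_update_smul]
    congr 1
    ext1 v
    rcases eq_or_ne v j with rfl | h
    · simp [hj]
    · rcases eq_or_ne v i with rfl | h'
      · simp [hi, h, entryOp]
      · simp [outcomeOp, h, h', entryOp]
  · intro v hv
    have h1 : v ≠ i := fun h => hi (h ▸ hv)
    have h2 : v ≠ j := fun h => hj (h ▸ hv)
    simp [entryOp, h1, h2]
  · intro v hv
    rcases eq_or_ne v j with rfl | h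
    · simp [F.expect_dual_smul, entryOp]
    · simp [h]

end conditioning

section energy

variable {V : Type*} [Fintype V] [DecidableEq V] {d : ℕ} {Ω : Type*} [Fintype Ω]
  (F : MeasurementFrame d Ω) (ρ : Matrix (V → Fin d) (V → Fin d) ℂ) (C : Finset V)

/-! ### Average purities -/

/-- The average purity of the site `i` after measuring the sites in `C`; it is set to its maximal
value `1` for `i ∈ C`. -/
def avgPurity (i : V) : ℝ :=
  if i ∈ C then 1 else 𝔼 z, (∑ a, ∑ b, ‖condOp F ρ C z i a b‖ ^ 2) / outcomeProb F ρ C z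

/-- The change of the conditional state of `i` caused by measuring the further site `j`, weighted
with the probability of the outcomes. -/
def condDiff (i j : V) (z : V → Ω) (a b : Fin d) : ℂ :=
  condOp F ρ (insert j C) z i a b -
    outcomeProb F ρ (insert j C) z * (condOp F ρ C z i a b / outcomeProb F ρ C z)

variable {ρ C}

lemma avgPurity_nonneg (hρ : IsState ρ) (i : V) : 0 ≤ avgPurity F ρ C i := by
  unfold avgPurity
  split_ifs
  · exact zero_le_one
  · exact Finset.expect_nonneg fun z _ => div_nonneg (by positivity) (outcomeProb_nonneg F z hρ)

lemma avgPurity_le_one [Nonempty Ω] (hρ : IsState ρ) (i : V) : avgPurity F ρ C i ≤ 1 := by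
  unfold avgPurity
  split_ifs with hi
  · exact le_rfl
  · rw [← expect_outcomeProb F hρ (C := C)]
    refine Finset.expect_le_expect fun z _ => ?_
    exact div_le_of_le_mul₀ (outcomeProb_nonneg F z hρ) (outcomeProb_nonneg F z hρ)
      ((sum_norm_sq_condOp_le F z hρ hi).trans_eq (sq _))

lemma expect_condDiff {i j : V} (hρ : IsState ρ) (hij : i ≠ j) (hi : i ∉ C) (hj : j ∉ C)
    (a b : Fin d) :
    𝔼 z, ‖condDiff F ρ C i j z a b‖ ^ 2 / outcomeProb F ρ (insert j C) z =
      𝔼 z, ‖condOp F ρ (insert j C) z i a b‖ ^ 2 / outcomeProb F ρ (insert j C) z -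
        𝔼 z, ‖condOp F ρ C z i a b‖ ^ 2 / outcomeProb F ρ C z := by
  have hi' : i ∉ insert j C := by simp [hij, hi]
  -- Expanding the square leaves terms that depend on the outcome at `j` only linearly.
  have hexp : ∀ z, ‖condDiff F ρ C i j z a b‖ ^ 2 / outcomeProb F ρ (insert j C) z =
      ‖condOp F ρ (insert j C) z i a b‖ ^ 2 / outcomeProb F ρ (insert j C) z -
        (2 * (condOp F ρ (insert j C) z i a b * star (condOp F ρ C z i a b)).re /
          outcomeProb F ρ C z -
        outcomeProb F ρ (insert j C) z *
          (‖condOp F ρ C z i a b‖ ^ 2 / outcomeProb F ρ C z ^ 2)) := by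
    intro z
    have h0 : outcomeProb F ρ (insert j C) z = 0 → condOp F ρ (insert j C) z i a b = 0 :=
      fun h => by rw [condOp_eq_zero F z hρ hi' h]; rfl
    unfold condDiff
    generalize condOp F ρ (insert j C) z i a b = r' at *
    generalize condOp F ρ C z i a b = r
    generalize outcomeProb F ρ (insert j C) z = p' at *
    generalize outcomeProb F ρ C z = p
    rcases eq_or_ne p' 0 with hp' | hp'
    · simp [hp', h0 hp']
    rcases eq_or_ne p 0 with rfl | hp
    · simp
    have hsub : r' - p' * (r / p) = r' - ((p' / p : ℝ) : ℂ) * r := by push_cast; ring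
    rw [hsub, ← Complex.normSq_eq_norm_sq, Complex.normSq_sub, Complex.normSq_mul,
      Complex.normSq_ofReal, ← Complex.normSq_eq_norm_sq, ← Complex.normSq_eq_norm_sq, map_mul,
      Complex.conj_ofReal, mul_left_comm, Complex.re_ofReal_mul]
    simp only [Complex.star_def]
    field_simp
    ring
  have hlin : 𝔼 z, (2 * (condOp F ρ (insert j C) z i a b * star (condOp F ρ C z i a b)).re /
          outcomeProb F ρ C z -
        outcomeProb F ρ (insert j C) z *
          (‖condOp F ρ C z i a b‖ ^ 2 / outcomeProb F ρ C z ^ 2)) =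
      𝔼 z, ‖condOp F ρ C z i a b‖ ^ 2 / outcomeProb F ρ C z := by
    refine expect_eq_of_resample j fun z => ?_
    simp only [condOp_update F z hj, outcomeProb_update F z hj]
    rw [Finset.expect_sub_distrib, ← Finset.expect_mul, ← Finset.expect_div, ← Finset.mul_expect,
      ← re_expect, ← Finset.expect_mul, expect_outcomeProb_insert F z hρ hj,
      expect_condOp_insert F z hij hj, Complex.star_def, Complex.mul_conj, Complex.ofReal_re,
      Complex.normSq_eq_norm_sq]
    rcases eq_or_ne (outcomeProb F ρ C z) 0 with hp | hp
    · simp [hp]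
    · field_simp
      ring
  simp only [hexp]
  rw [Finset.expect_sub_distrib, hlin]

lemma sum_expect_condDiff {i j : V} (hρ : IsState ρ) (hij : i ≠ j) (hi : i ∉ C) (hj : j ∉ C) :
    ∑ a, ∑ b, 𝔼 z, ‖condDiff F ρ C i j z a b‖ ^ 2 / outcomeProb F ρ (insert j C) z =
      avgPurity F ρ (insert j C) i - avgPurity F ρ C i := by
  have hi' : i ∉ insert j C := by simp [hij, hi]
  simp only [expect_condDiff F hρ hij hi hj, avgPurity, hi, hi', if_false, Finset.sum_sub_distrib,
    ← Finset.expect_sum_comm, Finset.sum_div]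

lemma avgPurity_le_insert [Nonempty Ω] (hρ : IsState ρ) (i j : V) :
    avgPurity F ρ C i ≤ avgPurity F ρ (insert j C) i := by
  by_cases hj : j ∈ C
  · rw [Finset.insert_eq_of_mem hj]
  by_cases hi : i ∈ insert j C
  · rw [avgPurity.eq_def F ρ (insert j C), if_pos hi]
    exact avgPurity_le_one F hρ i
  · rw [Finset.mem_insert, not_or] at hi
    rw [← sub_nonneg, ← sum_expect_condDiff F hρ hi.1 hi.2 hj]
    exact Finset.sum_nonneg fun a _ => Finset.sum_nonneg fun b _ => Finset.expect_nonneg fun z _ =>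
      div_nonneg (by positivity) (outcomeProb_nonneg F z hρ)

/-! ### The separable approximation -/

variable (ρ C)

/-- The state of the site `v` conditioned on the outcomes `z` on `C`; for `v ∈ C`, and for outcomes
of probability zero, it is the fixed pure state `e_0`. -/
def condState [NeZero d] (z : V → Ω) (v : V) : Matrix (Fin d) (Fin d) ℂ :=
  if v ∈ C ∨ outcomeProb F ρ C z = 0 then Matrix.single 0 0 1
  else (outcomeProb F ρ C z)⁻¹ • condOp F ρ C z v

/-- The separable state obtained by measuring the sites in `C` and then preparing, given the
outcomes, the conditional states of all sites independently of each other. -/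
def sepState [NeZero d] : Matrix (V → Fin d) (V → Fin d) ℂ :=
  ∑ z : V → Ω, (outcomeProb F ρ C z / Fintype.card (V → Ω)) • productOp (condState F ρ C z)

variable {ρ C}

lemma condState_isState [NeZero d] (hρ : IsState ρ) (z : V → Ω) (v : V) :
    IsState (condState F ρ C z v) := by
  unfold condState
  split_ifs with h
  · refine ⟨?_, by simp⟩
    have := Matrix.posSemidef_vecMulVec_self_star (Pi.single (0 : Fin d) (1 : ℂ))
    convert this using 1
    ext a b
    simp [Matrix.vecMulVec_apply, Matrix.single_apply, Pi.single_apply, ite_and, eq_comm]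
    split_ifs <;> rfl
  · rw [not_or] at h
    refine ⟨(condOp_posSemidef F z hρ v).smul (inv_nonneg.mpr (outcomeProb_nonneg F z hρ)), ?_⟩
    rw [Matrix.trace_smul, trace_condOp F z hρ h.1, Complex.real_smul, ← Complex.ofReal_mul,
      inv_mul_cancel₀ h.2, Complex.ofReal_one]

lemma sum_outcomeProb_div_card [Nonempty Ω] (hρ : IsState ρ) :
    ∑ z : V → Ω, outcomeProb F ρ C z / Fintype.card (V → Ω) = 1 := by
  rw [← Finset.sum_div, ← Fintype.expect_eq_sum_div_card, expect_outcomeProb F hρ]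

lemma sepState_isFullySeparable [NeZero d] [Nonempty Ω] (hρ : IsState ρ) :
    IsFullySeparable (sepState F ρ C) := by
  refine (convex_convexHull ℝ _).sum_mem (fun z _ => ?_) (sum_outcomeProb_div_card F hρ)
    fun z _ => subset_convexHull ℝ _ ⟨condState F ρ C z, condState_isState F hρ z, rfl⟩
  exact div_nonneg (outcomeProb_nonneg F z hρ) (Nat.cast_nonneg _)

lemma sepState_isState [NeZero d] [Nonempty Ω] (hρ : IsState ρ) : IsState (sepState F ρ C) := by
  constructor
  · refine Matrix.posSemidef_sum _ fun z _ => ?_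
    exact (productOp_isState (condState_isState F hρ z)).1.smul
      (div_nonneg (outcomeProb_nonneg F z hρ) (Nat.cast_nonneg _))
  · simp only [sepState, Matrix.trace_sum, Matrix.trace_smul,
      (productOp_isState (condState_isState F hρ _)).2, Complex.real_smul, mul_one]
    rw [← Complex.ofReal_sum, sum_outcomeProb_div_card F hρ, Complex.ofReal_one]

lemma reduce_sepState_apply [NeZero d] (S : Finset V)
    (x y : {v // v ∈ S} → Fin d) :
    reduce S (sepState F ρ C) x y =
      𝔼 z, (outcomeProb F ρ C z : ℂ) * reduce S (productOp (condState F ρ C z)) x y := by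
  rw [Fintype.expect_eq_sum_div_card, Finset.sum_div]
  simp only [reduce, sepState, Matrix.of_apply, Matrix.sum_apply, Matrix.smul_apply,
    Complex.real_smul, Finset.mul_sum, Finset.sum_div]
  rw [Finset.sum_comm]
  refine Finset.sum_congr rfl fun z _ => Finset.sum_congr rfl fun w _ => ?_
  push_cast
  ring

lemma reduce_productOp_singleton {s : V → Matrix (Fin d) (Fin d) ℂ} (hs : ∀ v, IsState (s v))
    {i : V} (x y : {v // v ∈ ({i} : Finset V)} → Fin d) :
    reduce {i} (productOp s) x y = s i (x ⟨i, by simp⟩) (y ⟨i, by simp⟩) := by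
  rw [reduce_apply, expectation_productOp, Fintype.prod_eq_single i]
  · simp [entryOp, Matrix.trace_mul_single]
  · intro v hv
    simp [entryOp, hv, (hs v).2]

lemma reduce_productOp_pair {s : V → Matrix (Fin d) (Fin d) ℂ} (hs : ∀ v, IsState (s v))
    {i j : V} (hij : i ≠ j) (x y : {v // v ∈ ({i, j} : Finset V)} → Fin d) :
    reduce {i, j} (productOp s) x y =
      s i (x ⟨i, by simp⟩) (y ⟨i, by simp⟩) * s j (x ⟨j, by simp⟩) (y ⟨j, by simp⟩) := by
  rw [reduce_apply, expectation_productOp, Fintype.prod_eq_mul i j hij]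
  · simp [entryOp, Matrix.trace_mul_single]
  · intro v hv
    simp [entryOp, hv.1, hv.2, (hs v).2]

/-- Measuring other sites does not change the state of a site on average. -/
lemma reduce_singleton_sub_sepState [NeZero d] [Nonempty Ω] (hρ : IsState ρ) {i : V}
    (hi : i ∉ C) : reduce {i} ρ - reduce {i} (sepState F ρ C) = 0 := by
  rw [sub_eq_zero]
  ext x y
  rw [reduce_sepState_apply, reduce_singleton_apply F hi]
  refine Finset.expect_congr rfl fun z _ => ?_
  rw [reduce_productOp_singleton (condState_isState F hρ z)]
  rcases eq_or_ne (outcomeProb F ρ C z) 0 with hp | hp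
  · simp [condOp_eq_zero F z hρ hi hp, hp]
  · have : (outcomeProb F ρ C z : ℂ) ≠ 0 := Complex.ofReal_ne_zero.mpr hp
    simp [condState, hi, hp, this]

lemma reduce_pair_sub_sepState [NeZero d] [Nonempty Ω] (hρ : IsState ρ) {i j : V} (hij : i ≠ j)
    (hi : i ∉ C) (hj : j ∉ C) (x y : {v // v ∈ ({i, j} : Finset V)} → Fin d) :
    (reduce {i, j} ρ - reduce {i, j} (sepState F ρ C)) x y =
      𝔼 z, F.dual (z j) (x ⟨j, by simp⟩) (y ⟨j, by simp⟩) *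
        condDiff F ρ C i j z (x ⟨i, by simp⟩) (y ⟨i, by simp⟩) := by
  simp only [condDiff, mul_sub]
  rw [Matrix.sub_apply, reduce_pair_apply F hij hi hj, Finset.expect_sub_distrib]
  congr 1
  rw [reduce_sepState_apply]
  symm
  refine expect_eq_of_resample j fun z => ?_
  simp only [condOp_update F z hj, outcomeProb_update F z hj, Function.update_self, ← mul_assoc]
  rw [← Finset.expect_mul, expect_dual_mul_outcomeProb F z hρ hj,
    reduce_productOp_pair (condState_isState F hρ z) hij]
  rcases eq_or_ne (outcomeProb F ρ C z) 0 with hp | hp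
  · simp [hp]
  · have : (outcomeProb F ρ C z : ℂ) ≠ 0 := Complex.ofReal_ne_zero.mpr hp
    simp only [condState, hi, hj, hp, or_self, if_false, Matrix.smul_apply, Complex.real_smul,
      Complex.ofReal_inv]
    field_simp

omit [Fintype V] in
lemma sum_comp_pair_le {S : Finset V} {i j : V} (hS : S = {i, j}) (hi : i ∈ S) (hj : j ∈ S)
    {g : Fin d → Fin d → ℝ} (hg : ∀ a b, 0 ≤ g a b) :
    ∑ x : {v // v ∈ S} → Fin d, g (x ⟨i, hi⟩) (x ⟨j, hj⟩) ≤ ∑ a, ∑ b, g a b := by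
  have hinj : Function.Injective fun x : {v // v ∈ S} → Fin d => (x ⟨i, hi⟩, x ⟨j, hj⟩) := by
    intro x y h
    simp only [Prod.mk.injEq] at h
    funext ⟨v, hv⟩
    rw [hS, Finset.mem_insert, Finset.mem_singleton] at hv
    rcases hv with rfl | rfl
    exacts [h.1, h.2]
  rw [← Fintype.sum_prod_type']
  calc _ = ∑ p ∈ Finset.univ.image fun x : {v // v ∈ S} → Fin d => (x ⟨i, hi⟩, x ⟨j, hj⟩),
        g p.1 p.2 := (Finset.sum_image hinj.injOn).symm
    _ ≤ _ := Finset.sum_le_sum_of_subset_of_nonneg (Finset.subset_univ _) fun p _ _ => hg _ _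

omit [Fintype V] in
lemma sum_sum_comp_pair_le {S : Finset V} {i j : V} (hS : S = {i, j}) (hi : i ∈ S) (hj : j ∈ S)
    {P Q : Fin d → Fin d → ℝ} (hP : ∀ a b, 0 ≤ P a b) (hQ : ∀ a b, 0 ≤ Q a b) :
    ∑ x : {v // v ∈ S} → Fin d, ∑ y : {v // v ∈ S} → Fin d,
      P (x ⟨j, hj⟩) (y ⟨j, hj⟩) * Q (x ⟨i, hi⟩) (y ⟨i, hi⟩) ≤
        (∑ a, ∑ b, P a b) * ∑ a, ∑ b, Q a b := by
  calc _ ≤ ∑ x : {v // v ∈ S} → Fin d, ∑ a', ∑ b', P (x ⟨j, hj⟩) b' * Q (x ⟨i, hi⟩) a' :=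
        Finset.sum_le_sum fun x _ => sum_comp_pair_le hS hi hj
          (g := fun a' b' => P (x ⟨j, hj⟩) b' * Q (x ⟨i, hi⟩) a')
          fun a' b' => mul_nonneg (hP _ _) (hQ _ _)
    _ ≤ ∑ a, ∑ b, ∑ a', ∑ b', P b b' * Q a a' :=
        sum_comp_pair_le hS hi hj (g := fun a b => ∑ a', ∑ b', P b b' * Q a a')
          fun a b => Finset.sum_nonneg fun a' _ => Finset.sum_nonneg fun b' _ =>
            mul_nonneg (hP _ _) (hQ _ _)
    _ = (∑ a, ∑ b, P a b) * ∑ a, ∑ b, Q a b := by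
        rw [Finset.sum_mul_sum, Finset.sum_comm]
        refine Finset.sum_congr rfl fun b _ => Finset.sum_congr rfl fun a _ => ?_
        rw [Finset.sum_mul_sum, Finset.sum_comm]

/-- The Frobenius distance of the pair reductions is controlled by the gain in purity of `i` from
measuring `j`. -/
lemma sum_norm_sq_reduce_pair_le [NeZero d] [Nonempty Ω] (hρ : IsState ρ) {i j : V} (hij : i ≠ j)
    (hi : i ∉ C) (hj : j ∉ C) :
    ∑ x, ∑ y, ‖(reduce {i, j} ρ - reduce {i, j} (sepState F ρ C)) x y‖ ^ 2 ≤
      4 * (d : ℝ) ^ 2 * (avgPurity F ρ (insert j C) i - avgPurity F ρ C i) := by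
  have hi' : i ∉ insert j C := by simp [hij, hi]
  let P : Fin d → Fin d → ℝ := fun a b =>
    𝔼 z : V → Ω, outcomeProb F ρ (insert j C) z * ‖F.dual (z j) a b‖ ^ 2
  let Q : Fin d → Fin d → ℝ := fun a b =>
    𝔼 z, ‖condDiff F ρ C i j z a b‖ ^ 2 / outcomeProb F ρ (insert j C) z
  have hp := fun z => outcomeProb_nonneg F z hρ (C := insert j C)
  have hP : ∀ a b, 0 ≤ P a b := fun a b => Finset.expect_nonneg fun z _ =>
    mul_nonneg (hp z) (by positivity)
  have hQ : ∀ a b, 0 ≤ Q a b := fun a b => Finset.expect_nonneg fun z _ =>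
    div_nonneg (by positivity) (hp z)
  have hsumP : ∑ a, ∑ b, P a b = 4 * (d : ℝ) ^ 2 := by
    simp only [P, ← Finset.expect_sum_comm, ← Finset.mul_sum, F.sum_norm_dual]
    rw [← Finset.expect_mul, expect_outcomeProb F hρ, one_mul]
  have hentry : ∀ x y : {v // v ∈ ({i, j} : Finset V)} → Fin d,
      ‖(reduce {i, j} ρ - reduce {i, j} (sepState F ρ C)) x y‖ ^ 2 ≤
        P (x ⟨j, by simp⟩) (y ⟨j, by simp⟩) * Q (x ⟨i, by simp⟩) (y ⟨i, by simp⟩) := by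
    intro x y
    rw [reduce_pair_sub_sepState F hρ hij hi hj]
    refine (pow_le_pow_left₀ (norm_nonneg _) (RCLike.norm_expect_le (K := ℂ)) 2).trans
      (expect_sq_le_expect_mul_expect (fun z => mul_nonneg (hp z) (by positivity))
        (fun z => div_nonneg (by positivity) (hp z)) fun z => ?_)
    rw [norm_mul]
    rcases eq_or_ne (outcomeProb F ρ (insert j C) z) 0 with h0 | h0
    · simp [condDiff, h0, condOp_eq_zero F z hρ hi' h0]
    · field_simp
  refine (Finset.sum_le_sum fun x _ => Finset.sum_le_sum fun y _ => hentry x y).trans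
    ((sum_sum_comp_pair_le rfl _ _ hP hQ).trans_eq ?_)
  rw [hsumP, sum_expect_condDiff F hρ hij hi hj]

lemma traceNorm_reduce_pair_le [NeZero d] [Nonempty Ω] (hρ : IsState ρ) {i j : V} (hij : i ≠ j)
    (hi : i ∉ C) (hj : j ∉ C) :
    traceNorm (reduce {i, j} ρ - reduce {i, j} (sepState F ρ C)) ≤
      2 * (d : ℝ) ^ 2 * √(avgPurity F ρ (insert j C) i - avgPurity F ρ C i) := by
  refine (traceNorm_le_sqrt_card_mul _).trans ?_
  have hcard : (Fintype.card ({v // v ∈ ({i, j} : Finset V)} → Fin d) : ℝ) = (d : ℝ) ^ 2 := by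
    rw [Fintype.card_fun, Fintype.card_coe, Finset.card_pair hij, Fintype.card_fin, Nat.cast_pow]
  rw [hcard, Real.sqrt_sq (Nat.cast_nonneg d)]
  calc _ ≤ (d : ℝ) * √((2 * d) ^ 2 * (avgPurity F ρ (insert j C) i - avgPurity F ρ C i)) := by
        gcongr
        refine (sum_norm_sq_reduce_pair_le F hρ hij hi hj).trans_eq ?_
        ring
    _ = _ := by
        rw [Real.sqrt_mul (by positivity), Real.sqrt_sq (by positivity)]
        ring

/-- The bound for all pairs. A measured site is charged the trivial bound `2`. -/
lemma traceNorm_reduce_le [NeZero d] [Nonempty Ω] (hρ : IsState ρ) (i j : V) :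
    traceNorm (reduce {i, j} ρ - reduce {i, j} (sepState F ρ C)) ≤
      2 * (if i ∈ C then 1 else 0) + 2 * (if j ∈ C then 1 else 0) +
        2 * (d : ℝ) ^ 2 * √(avgPurity F ρ (insert j C) i - avgPurity F ρ C i) := by
  have h2 : traceNorm (reduce {i, j} ρ - reduce {i, j} (sepState F ρ C)) ≤ 2 :=
    traceNorm_sub_le_two (reduce_isState hρ _) (reduce_isState (sepState_isState F hρ) _)
  have h0 : 0 ≤ 2 * (d : ℝ) ^ 2 * √(avgPurity F ρ (insert j C) i - avgPurity F ρ C i) := by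
    positivity
  by_cases hi : i ∈ C
  · rw [if_pos hi]
    split_ifs <;> linarith
  by_cases hj : j ∈ C
  · rw [if_pos hj, if_neg hi]
    linarith
  rw [if_neg hi, if_neg hj]
  rcases eq_or_ne i j with rfl | hij
  · rw [Finset.pair_eq_singleton, reduce_singleton_sub_sepState F hρ hi]
    have : traceNorm (0 : Matrix ({v // v ∈ ({i} : Finset V)} → Fin d) _ ℂ) ≤ 0 :=
      (traceNorm_le_sqrt_card_mul _).trans_eq (by simp)
    linarith
  · have := traceNorm_reduce_pair_le F hρ hij hi hj
    linarith

end energy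

/-! ### Choosing the measured sites -/

section choice

variable {V : Type*} [Fintype V] [DecidableEq V]

lemma sum_mul_mass_insert_le {w : V → ℝ} (hw : ∀ i, 0 ≤ w i) (hw1 : ∑ i, w i = 1)
    (C : Finset V) :
    ∑ j, w j * ∑ i ∈ insert j C, w i ≤ ∑ i ∈ C, w i + ∑ i, w i ^ 2 := by
  calc ∑ j, w j * ∑ i ∈ insert j C, w i ≤ ∑ j, w j * (w j + ∑ i ∈ C, w i) := by
        gcongr with j
        · exact hw j
        · by_cases hj : j ∈ C
          · rw [Finset.insert_eq_of_mem hj]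
            linarith [hw j]
          · rw [Finset.sum_insert hj]
    _ = ∑ i ∈ C, w i + ∑ i, w i ^ 2 := by
        simp only [mul_add, Finset.sum_add_distrib, ← Finset.sum_mul, hw1, one_mul, sq]
        ring

/-- Let `φ` be a potential with values in `[0, 1]` and gain `ψ` when a random site, drawn with the
probabilities `w`, is added. Among the sets of at most `m - 1` independent random sites there is one
for which a combination of the gain and the mass `∑ i ∈ C, w i` is at most its average. -/
lemma exists_finset_gain_add_mass_le {w : V → ℝ} (hw : ∀ i, 0 ≤ w i) (hw1 : ∑ i, w i = 1)
    {φ ψ : Finset V → ℝ} (hφ0 : ∀ C, 0 ≤ φ C) (hφ1 : ∀ C, φ C ≤ 1)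
    (hψ : ∀ C, ψ C = ∑ j, w j * φ (insert j C) - φ C) {α : ℝ} (hα : 0 ≤ α) {m : ℕ} (hm : 0 < m) :
    ∃ C, α * ψ C + 4 * ∑ i ∈ C, w i ≤ α / m + 2 * (m - 1) * ∑ i, w i ^ 2 := by
  by_contra! h
  set B := α / m + 2 * ((m : ℝ) - 1) * ∑ i, w i ^ 2 with hB
  set P := ∑ i, w i ^ 2
  -- If all sets were bad, `k` further random sites would contribute more than `k * B` in total.
  have key : ∀ (k : ℕ) (C : Finset V), k * B ≤
      α * (1 - φ C) + 4 * k * ∑ i ∈ C, w i + 2 * k * (k - 1) * P ∧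
      (0 < k → k * B < α * (1 - φ C) + 4 * k * ∑ i ∈ C, w i + 2 * k * (k - 1) * P) := by
    intro k
    induction k with
    | zero =>
      intro C
      have := mul_nonneg hα (sub_nonneg.mpr (hφ1 C))
      simpa using this
    | succ k ih =>
      intro C
      suffices hlt : ((k + 1 : ℕ) : ℝ) * B < α * (1 - φ C) + 4 * ((k + 1 : ℕ) : ℝ) * ∑ i ∈ C, w i +
          2 * ((k + 1 : ℕ) : ℝ) * (((k + 1 : ℕ) : ℝ) - 1) * P from ⟨hlt.le, fun _ => hlt⟩
      have havg : k * B ≤ ∑ j, w j * (α * (1 - φ (insert j C)) +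
          4 * k * ∑ i ∈ insert j C, w i + 2 * k * (k - 1) * P) := by
        calc k * B = ∑ j, w j * (k * B) := by rw [← Finset.sum_mul, hw1, one_mul]
          _ ≤ _ := Finset.sum_le_sum fun j _ => mul_le_mul_of_nonneg_left (ih _).1 (hw j)
      have hexp : ∑ j, w j * (α * (1 - φ (insert j C)) +
          4 * k * ∑ i ∈ insert j C, w i + 2 * k * (k - 1) * P) =
          α * (1 - (ψ C + φ C)) + 4 * k * ∑ j, w j * ∑ i ∈ insert j C, w i +
            2 * k * (k - 1) * P := by
        have h1 : ∀ j, w j * (α * (1 - φ (insert j C)) +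
            4 * k * ∑ i ∈ insert j C, w i + 2 * k * (k - 1) * P) =
            w j * (α + 2 * k * (k - 1) * P) - α * (w j * φ (insert j C)) +
              4 * k * (w j * ∑ i ∈ insert j C, w i) := fun j => by ring
        simp only [h1, Finset.sum_add_distrib, Finset.sum_sub_distrib, ← Finset.mul_sum,
          ← Finset.sum_mul, hw1, hψ C]
        ring
      have hmass := mul_le_mul_of_nonneg_left (sum_mul_mass_insert_le hw hw1 C)
        (by positivity : (0 : ℝ) ≤ 4 * k)
      have hC := h C
      push_cast
      linarith
  have hfin := (key m ∅).2 hm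
  have hm' : (0 : ℝ) < m := Nat.cast_pos.mpr hm
  have hmB : m * B = α + 2 * m * (m - 1) * P := by
    rw [hB]
    field_simp
  have := mul_nonneg hα (hφ0 ∅)
  rw [Finset.sum_empty] at hfin
  linarith

end choice

/-! ### The weight matrix -/

section weights

variable {V : Type*} [Fintype V] {G : Matrix V V ℝ}

lemma colSum_apply (j : V) : colSum G j = ∑ i, G i j := rfl

lemma colSum_nonneg (hG : ∀ i j, 0 ≤ G i j) (j : V) : 0 ≤ colSum G j :=
  Finset.sum_nonneg fun i _ => hG i j

lemma sum_colSum (hsum : ∑ i, ∑ j, G i j = 1) : ∑ j, colSum G j = 1 := by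
  simp only [colSum_apply]
  rw [Finset.sum_comm, hsum]

lemma norm_colSum_sq : ‖colSum G‖ ^ 2 = ∑ j, colSum G j ^ 2 := by
  simp [EuclideanSpace.norm_sq_eq]

lemma trace_normalized_sq [DecidableEq V] (hsymm : G.IsSymm) :
    (normalized G ^ 2).trace = ∑ i, ∑ j, G i j ^ 2 / (colSum G i * colSum G j) := by
  rw [sq]
  simp only [Matrix.trace, Matrix.diag, Matrix.mul_apply, normalized,
    Matrix.of_apply]
  refine Finset.sum_congr rfl fun i _ => Finset.sum_congr rfl fun j _ => ?_
  rw [hsymm.apply i j, div_mul_div_comm, ← sq, mul_comm (colSum G j)]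

lemma colSum_pos_of_pos (hsymm : G.IsSymm) (hG : ∀ i j, 0 ≤ G i j) {i j : V} (h : 0 < G i j) :
    0 < colSum G i ∧ 0 < colSum G j :=
  ⟨(hsymm.apply i j ▸ h).trans_le (Finset.single_le_sum (f := fun k => G k i)
      (fun k _ => hG k i) (Finset.mem_univ j)),
    h.trans_le (Finset.single_le_sum (f := fun k => G k j) (fun k _ => hG k j)
      (Finset.mem_univ i))⟩

lemma trace_normalized_sq_pos [DecidableEq V] (hsymm : G.IsSymm) (hG : ∀ i j, 0 ≤ G i j)
    (hsum : ∑ i, ∑ j, G i j = 1) : 0 < (normalized G ^ 2).trace := by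
  rw [trace_normalized_sq hsymm]
  have hterm : ∀ i j, 0 ≤ G i j ^ 2 / (colSum G i * colSum G j) := fun i j =>
    div_nonneg (sq_nonneg _) (mul_nonneg (colSum_nonneg hG i) (colSum_nonneg hG j))
  obtain ⟨i, -, hi⟩ := Finset.exists_ne_zero_of_sum_ne_zero (hsum.trans_ne one_ne_zero)
  obtain ⟨j, -, hj⟩ := Finset.exists_ne_zero_of_sum_ne_zero hi
  have hpos : 0 < G i j := lt_of_le_of_ne (hG i j) (Ne.symm hj)
  obtain ⟨h1, h2⟩ := colSum_pos_of_pos hsymm hG hpos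
  exact Finset.sum_pos' (fun i _ => Finset.sum_nonneg fun j _ => hterm i j) ⟨i, Finset.mem_univ i,
    Finset.sum_pos' (fun j _ => hterm i j) ⟨j, Finset.mem_univ j, by positivity⟩⟩

/-- The passage from pairs drawn with the weights `G` to pairs of independent sites. This is the
Cauchy–Schwarz inequality, linearized with a parameter `l`. -/
lemma sum_mul_sqrt_le [DecidableEq V] (hsymm : G.IsSymm) (hG : ∀ i j, 0 ≤ G i j) {δ : V → V → ℝ}
    (hδ : ∀ i j, 0 ≤ δ i j) (c : ℝ) {l : ℝ} (hl : 0 < l) :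
    ∑ i, ∑ j, G i j * (c * √(δ i j)) ≤
      l / 2 * (c ^ 2 * (normalized G ^ 2).trace) +
        1 / (2 * l) * ∑ i, ∑ j, colSum G i * colSum G j * δ i j := by
  rw [trace_normalized_sq hsymm]
  simp only [Finset.mul_sum, ← Finset.sum_add_distrib]
  refine Finset.sum_le_sum fun i _ => Finset.sum_le_sum fun j _ => ?_
  rcases (hG i j).eq_or_lt with h0 | hpos
  · rw [← h0]
    have := mul_nonneg (mul_nonneg (colSum_nonneg hG i) (colSum_nonneg hG j)) (hδ i j)
    simp only [zero_mul, ne_eq, OfNat.ofNat_ne_zero, not_false_eq_true, zero_pow, zero_div,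
      mul_zero, zero_add]
    positivity
  · obtain ⟨h1, h2⟩ := colSum_pos_of_pos hsymm hG hpos
    have hq : 0 < colSum G i * colSum G j := mul_pos h1 h2
    generalize colSum G i * colSum G j = q at hq
    have hs := Real.sq_sqrt (hδ i j)
    rw [← hs]
    simp only [Real.sqrt_sq (Real.sqrt_nonneg _)]
    have key : 0 ≤ (l * c * G i j - q * √(δ i j)) ^ 2 / (2 * l * q) := by positivity
    have : l / 2 * (c ^ 2 * (G i j ^ 2 / q)) + 1 / (2 * l) * (q * √(δ i j) ^ 2) -
        G i j * (c * √(δ i j)) = (l * c * G i j - q * √(δ i j)) ^ 2 / (2 * l * q) := by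
      field_simp
      ring
    linarith

end weights

/-! ### The approximation bound -/

section bound

variable {V : Type*} [Fintype V] [DecidableEq V] {d : ℕ} {G : Matrix V V ℝ}
  {ρ : Matrix (V → Fin d) (V → Fin d) ℂ}

lemma sum_mul_indicator (hsymm : G.IsSymm) (C : Finset V) :
    ∑ i, ∑ j, G i j * (2 * (if i ∈ C then 1 else 0) + 2 * (if j ∈ C then 1 else 0)) =
      4 * ∑ i ∈ C, colSum G i := by
  have h1 : ∑ i, ∑ j, G i j * (if j ∈ C then (1 : ℝ) else 0) = ∑ i ∈ C, colSum G i := by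
    rw [Finset.sum_comm]
    simp only [← Finset.sum_mul, ← colSum_apply]
    simp
  have h2 : ∑ i, ∑ j, G i j * (if i ∈ C then (1 : ℝ) else 0) = ∑ i ∈ C, colSum G i := by
    rw [← h1, Finset.sum_comm]
    exact Finset.sum_congr rfl fun i _ => Finset.sum_congr rfl fun j _ => by rw [hsymm.apply i j]
  simp only [mul_add, mul_left_comm _ (2 : ℝ), Finset.sum_add_distrib, ← Finset.mul_sum, h1, h2]
  ring

/-- The average purity of a site drawn with the probabilities `colSum G`, after measuring `C`. -/
def totalPurity {Ω : Type*} [Fintype Ω] (F : MeasurementFrame d Ω) (G : Matrix V V ℝ)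
    (ρ : Matrix (V → Fin d) (V → Fin d) ℂ) (C : Finset V) : ℝ :=
  ∑ i, colSum G i * avgPurity F ρ C i

lemma sum_traceNorm_le [NeZero d] {Ω : Type*} [Fintype Ω] [Nonempty Ω] (F : MeasurementFrame d Ω)
    (hsymm : G.IsSymm) (hG : ∀ i j, 0 ≤ G i j) (hsum : ∑ i, ∑ j, G i j = 1) (hρ : IsState ρ)
    (C : Finset V) {l : ℝ} (hl : 0 < l) :
    ∑ i, ∑ j, G i j * traceNorm (reduce {i, j} ρ - reduce {i, j} (sepState F ρ C)) ≤
      l / 2 * (4 * (d : ℝ) ^ 4 * (normalized G ^ 2).trace) +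
        (1 / (2 * l) * (∑ j, colSum G j * totalPurity F G ρ (insert j C) - totalPurity F G ρ C) +
        4 * ∑ i ∈ C, colSum G i) := by
  have hgain : ∑ i, ∑ j, colSum G i * colSum G j *
      (avgPurity F ρ (insert j C) i - avgPurity F ρ C i) =
      ∑ j, colSum G j * totalPurity F G ρ (insert j C) - totalPurity F G ρ C := by
    have h1 : totalPurity F G ρ C = ∑ j, colSum G j * totalPurity F G ρ C := by
      rw [← Finset.sum_mul, sum_colSum hsum, one_mul]
    rw [h1, ← Finset.sum_sub_distrib, Finset.sum_comm]
    simp only [totalPurity, ← mul_sub, ← Finset.sum_sub_distrib, Finset.mul_sum]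
    exact Finset.sum_congr rfl fun i _ => Finset.sum_congr rfl fun j _ => by ring
  calc _ ≤ ∑ i, ∑ j, G i j * (2 * (if i ∈ C then 1 else 0) + 2 * (if j ∈ C then 1 else 0) +
        2 * (d : ℝ) ^ 2 * √(avgPurity F ρ (insert j C) i - avgPurity F ρ C i)) := by
        gcongr with i _ j _
        · exact hG i j
        · exact traceNorm_reduce_le F hρ i j
    _ = ∑ i, ∑ j, G i j *
          (2 * (d : ℝ) ^ 2 * √(avgPurity F ρ (insert j C) i - avgPurity F ρ C i)) +
        4 * ∑ i ∈ C, colSum G i := by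
        rw [← sum_mul_indicator hsymm, ← Finset.sum_add_distrib]
        simp only [← Finset.sum_add_distrib, ← mul_add]
        refine Finset.sum_congr rfl fun i _ => Finset.sum_congr rfl fun j _ => ?_
        rw [add_comm]
    _ ≤ l / 2 * ((2 * (d : ℝ) ^ 2) ^ 2 * (normalized G ^ 2).trace) +
        1 / (2 * l) * (∑ j, colSum G j * totalPurity F G ρ (insert j C) - totalPurity F G ρ C) +
        4 * ∑ i ∈ C, colSum G i := by
        rw [← hgain]
        exact add_le_add_left (sum_mul_sqrt_le hsymm hG
          (fun i j => sub_nonneg.mpr (avgPurity_le_insert F hρ i j)) _ hl) _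
    _ = _ := by ring

lemma totalPurity_nonneg {Ω : Type*} [Fintype Ω] (F : MeasurementFrame d Ω)
    (hG : ∀ i j, 0 ≤ G i j) (hρ : IsState ρ) (C : Finset V) : 0 ≤ totalPurity F G ρ C :=
  Finset.sum_nonneg fun i _ => mul_nonneg (colSum_nonneg hG i) (avgPurity_nonneg F hρ i)

lemma totalPurity_le_one {Ω : Type*} [Fintype Ω] [Nonempty Ω] (F : MeasurementFrame d Ω)
    (hG : ∀ i j, 0 ≤ G i j) (hsum : ∑ i, ∑ j, G i j = 1) (hρ : IsState ρ) (C : Finset V) :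
    totalPurity F G ρ C ≤ 1 := by
  rw [← sum_colSum hsum]
  exact Finset.sum_le_sum fun i _ =>
    mul_le_of_le_one_right (colSum_nonneg hG i) (avgPurity_le_one F hρ i)

/-- The bound with exponent `1 / 3`. The parameter `m` balances the error from
the remaining correlations, of order `√(a / m)` for `a = 4 * d ^ 4 * tr (A ^ 2)`, against the
error `2 * (m - 1) * ‖π‖ ^ 2` from the measured sites, of which there are at most `m - 1`. -/
lemma exists_separable_sum_traceNorm_le [NeZero d] (hsymm : G.IsSymm) (hG : ∀ i j, 0 ≤ G i j)
    (hsum : ∑ i, ∑ j, G i j = 1) (hρ : IsState ρ) :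
    ∃ σ, IsFullySeparable σ ∧ IsState σ ∧
      ∑ i, ∑ j, G i j * traceNorm (reduce {i, j} ρ - reduce {i, j} σ) ≤
        3 * (4 * (d : ℝ) ^ 4 * (normalized G ^ 2).trace * ‖colSum G‖ ^ 2) ^ (1 / 3 : ℝ) := by
  set a := 4 * (d : ℝ) ^ 4 * (normalized G ^ 2).trace with ha
  set P := ‖colSum G‖ ^ 2 with hP
  have hd : (0 : ℝ) < d := Nat.cast_pos.mpr (NeZero.pos d)
  have ha0 : 0 < a := mul_pos (by positivity) (trace_normalized_sq_pos hsymm hG hsum)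
  have hP0 : 0 < P := by
    refine pow_pos (norm_pos_iff.mpr fun h => ?_) 2
    have := sum_colSum hsum
    simp [h] at this
  set u := (a * P) ^ (1 / 3 : ℝ) with hu
  have hu0 : 0 < u := Real.rpow_pos_of_pos (mul_pos ha0 hP0) _
  have hu3 : u ^ 3 = a * P := by
    rw [hu, ← Real.rpow_natCast, ← Real.rpow_mul (mul_pos ha0 hP0).le]
    norm_num
  -- With `m = n + 1 ≈ u / P` both errors are of order `u = √(a / m) = m * P`, and
  -- `l = u / a` is the optimal parameter in the linearized Cauchy–Schwarz inequality.
  set n := ⌊u / P⌋₊ with hn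
  have hn1 : (n : ℝ) ≤ u / P := Nat.floor_le (by positivity)
  have hn2 : u / P < n + 1 := Nat.lt_floor_add_one _
  let F := pairFrame d
  obtain ⟨C, hC⟩ := exists_finset_gain_add_mass_le (colSum_nonneg hG) (sum_colSum hsum)
    (totalPurity_nonneg F hG hρ) (totalPurity_le_one F hG hsum hρ) (fun _ => rfl)
    (α := 1 / (2 * (u / a))) (by positivity) n.succ_pos
  refine ⟨sepState F ρ C, sepState_isFullySeparable F hρ, sepState_isState F hρ,
    (sum_traceNorm_le F hsymm hG hsum hρ C (div_pos hu0 ha0)).trans ?_⟩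
  rw [← norm_colSum_sq] at hC
  have h1 : u / a / 2 * a = u / 2 := by field_simp
  have h2 : 1 / (2 * (u / a)) / (n.succ : ℝ) ≤ u / 2 := by
    rw [div_le_iff₀ (by positivity)]
    have h : 1 / (2 * (u / a)) = u / 2 * (u / P) := by
      field_simp
      linarith
    rw [h, Nat.cast_succ]
    exact mul_le_mul_of_nonneg_left hn2.le (by positivity)
  have h3 : 2 * ((n.succ : ℝ) - 1) * P ≤ 2 * u := by
    have := (le_div_iff₀ hP0).mp hn1
    push_cast
    linarith
  linarith

end bound

end

end QSites

theorem theorem8 {V : Type*} [Fintype V] [DecidableEq V] (d : ℕ)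
    (G : Matrix V V ℝ) (hsymm : G.IsSymm) (hnonneg : ∀ i j, 0 ≤ G i j)
    (hsum : ∑ i, ∑ j, G i j = 1)
    (ρ : Matrix (V → Fin d) (V → Fin d) ℂ) (hρ : QSites.IsState ρ) :
    ∃ σ : Matrix (V → Fin d) (V → Fin d) ℂ, QSites.IsFullySeparable σ ∧
      ∑ i, ∑ j, G i j *
          QSites.traceNorm (QSites.reduce {i, j} ρ - QSites.reduce {i, j} σ) ≤
        47 * ((d : ℝ) ^ 4 * Real.log d * (QSites.normalized G ^ 2).trace *
            ‖QSites.colSum G‖ ^ 2) ^ (1 / 5 : ℝ) + 2 * ‖QSites.colSum G‖ ^ 2 := by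
  have hT := QSites.trace_normalized_sq_pos hsymm hnonneg hsum
  -- There are no states for `d = 0`, because there is at least one site.
  have hd0 : d ≠ 0 := by
    rintro rfl
    obtain ⟨i, -, -⟩ := Finset.exists_ne_zero_of_sum_ne_zero (hsum.trans_ne one_ne_zero)
    have : IsEmpty (V → Fin 0) := ⟨fun f => (f i).elim0⟩
    have h := hρ.2
    simp [Matrix.trace, Finset.univ_eq_empty] at h
  have : NeZero d := ⟨hd0⟩
  obtain ⟨σ, hsep, hσ, hbound⟩ := QSites.exists_separable_sum_traceNorm_le hsymm hnonneg hsum hρ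
  refine ⟨σ, hsep, ?_⟩
  set T := (QSites.normalized G ^ 2).trace
  set P := ‖QSites.colSum G‖ ^ 2
  have hP : 0 ≤ P := by positivity
  rcases Nat.lt_or_ge 1 d with hd | hd
  · -- For `x ≤ 1` the exponent `1 / 3` is stronger than `1 / 5`, and otherwise the bound is trivial.
    have hlog : (1 / 2 : ℝ) < Real.log d :=
      (by linarith [Real.log_two_gt_d9] : (1 / 2 : ℝ) < Real.log 2).trans_le
        (Real.log_le_log two_pos (by exact_mod_cast hd))
    set x := (d : ℝ) ^ 4 * Real.log d * T * P with hx
    have hx0 : 0 ≤ x := by positivity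
    rcases le_or_gt x 1 with hx1 | hx1
    · have h8 : 4 * (d : ℝ) ^ 4 * T * P ≤ 8 * x := by
        have : 0 ≤ (d : ℝ) ^ 4 * T * P := by positivity
        rw [hx]
        nlinarith
      have h3 : (4 * (d : ℝ) ^ 4 * T * P) ^ (1 / 3 : ℝ) ≤ 2 * x ^ (1 / 5 : ℝ) := by
        calc _ ≤ (8 * x) ^ (1 / 3 : ℝ) := Real.rpow_le_rpow (by positivity) h8 (by norm_num)
          _ = 2 * x ^ (1 / 3 : ℝ) := by
            rw [Real.mul_rpow (by norm_num) hx0, show (8 : ℝ) = 2 ^ (3 : ℝ) by norm_num,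
              ← Real.rpow_mul (by norm_num)]
            norm_num
          _ ≤ _ := by
            gcongr ?_ * ?_
            exact Real.rpow_le_rpow_of_exponent_ge' hx0 hx1 (by norm_num) (by norm_num)
      have : 0 ≤ x ^ (1 / 5 : ℝ) := Real.rpow_nonneg hx0 _
      linarith
    · have h1 : 1 ≤ x ^ (1 / 5 : ℝ) := Real.one_le_rpow hx1.le (by norm_num)
      have h2 : ∑ i, ∑ j, G i j *
          QSites.traceNorm (QSites.reduce {i, j} ρ - QSites.reduce {i, j} σ) ≤
            ∑ i, ∑ j, G i j * 2 := by
        gcongr with i _ j _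
        · exact hnonneg i j
        · exact QSites.traceNorm_sub_le_two (QSites.reduce_isState hρ _)
            (QSites.reduce_isState hσ _)
      simp only [← Finset.sum_mul, hsum] at h2
      linarith
  · -- For `d = 1` there is only one state, but the right-hand side has `log d = 0`.
    obtain rfl : d = 1 := le_antisymm hd (Nat.one_le_iff_ne_zero.mpr hd0)
    have heq : ρ = σ := by
      have h := hρ.2.trans hσ.2.symm
      ext x y
      simpa [Matrix.trace, Subsingleton.elim x default, Subsingleton.elim y default] using h
    have hzero : ∀ i j, QSites.traceNorm
        (QSites.reduce {i, j} ρ - QSites.reduce {i, j} σ) ≤ 0 := fun i j =>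
      (QSites.traceNorm_le_sqrt_card_mul _).trans_eq (by simp [heq])
    have hle : ∑ i, ∑ j, G i j *
        QSites.traceNorm (QSites.reduce {i, j} ρ - QSites.reduce {i, j} σ) ≤ 0 :=
      Finset.sum_nonpos fun i _ => Finset.sum_nonpos fun j _ =>
        mul_nonpos_of_nonneg_of_nonpos (hnonneg i j) (hzero i j)
    refine hle.trans ?_
    positivity
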